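/- **Theorem 3.1.** Let $M$ be a smooth manifold with a complete smooth Riemannian metric $g_M$. On $\overline M=M\times\mathbb R$ consider the Lorentzian metric $\overline g=g_M-dt^2$ and the Riemannian metric $\overline g_E=g_M+dt^2$, and write $|v|_E=\sqrt{\overline g_E(v,v)}$. Let $\Sigma^m$ be a connected smooth manifold and let $F:\Sigma^m\to\overline M$ be a smooth proper map which is a spacelike immersion, i.e. $g:=F^*\overline g$ is positive definite on $\Sigma$. For $x\in\Sigma$ put $$|\nu^{\min}|_E(x):=\min\{|\nu|_E:\ \nu\in T_{F(x)}\overline M,\ \overline g(\nu,\nu)=-1,\ \overline g(\nu,dF_x(v))=0\ \text{for all } v\in T_x\Sigma\}.$$ Fix $o\in\Sigma$ and let $r_E(x)$ be the distance from $o$ to $x$ in $\Sigma$ with respect to the Riemannian metric $g_E:=F^*\overline g_E$. Assume that $$|\nu^{\min}|_E(x)\le G(r_E(x))\qquad\text{for all }x\in\Sigma,$$ where $G:[0,\infty)\to\mathbb R$ is a continuous function with $G>0$ and $$\int_0^\infty\frac{dr}{G(r)}=\infty.$$ Then the induced Riemannian metric $g=F^*\overline g$ on $\Sigma$ is complete.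 (A Riemannian metric is complete if every Cauchy sequence for its distance, the infimum of lengths of $C^1$ paths, converges.) -/

import Mathlib

open Set Filter Topology MeasureTheory Manifold Bundle
open scoped Manifold ContDiff Bundle ENNReal

noncomputable section

namespace LorentzProduct

/-! ### Distance and completeness of a Riemannian metric on a manifold -/

section Riemannian

variable {k : ℕ} {X : Type*} [TopologicalSpace X] [ChartedSpace (EuclideanSpace ℝ (Fin k)) X]

/-- The (extended) distance of a Riemannian metric `g`: the infimum of the `g`-lengths of `C^1` paths
between the two points (for a continuous `g` it is `⊤` only for points that cannot be joined). -/
def metricEDist (g : RiemannianMetric (fun x : X ↦ TangentSpace (𝓡 k) x)) (x y : X) : ℝ≥0∞ :=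
  letI : RiemannianBundle (fun x : X ↦ TangentSpace (𝓡 k) x) := ⟨g⟩
  riemannianEDist (𝓡 k) x y

/-- A Riemannian metric is complete if every sequence which is Cauchy for its distance converges
for its distance. -/
def IsCompleteMetric (g : RiemannianMetric (fun x : X ↦ TangentSpace (𝓡 k) x)) : Prop :=
  ∀ u : ℕ → X,
    (∀ ε : ℝ≥0∞, 0 < ε → ∃ N : ℕ, ∀ i ≥ N, ∀ j ≥ N, metricEDist g (u i) (u j) < ε) →
    ∃ x : X, Tendsto (fun i ↦ metricEDist g (u i) x) atTop (𝓝 0)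

/-- A positive definite form on a Euclidean space has a bounded unit ball. -/
theorem isVonNBounded_of_posDef
    (B : EuclideanSpace ℝ (Fin k) →L[ℝ] EuclideanSpace ℝ (Fin k) →L[ℝ] ℝ)
    (hB : ∀ v, v ≠ 0 → 0 < B v v) : Bornology.IsVonNBounded ℝ {v | B v v < 1} := by
  have hcont : Continuous (fun v : EuclideanSpace ℝ (Fin k) ↦ B v v) := by fun_prop
  obtain ⟨c, hc, hcB⟩ : ∃ c : ℝ, 0 < c ∧ ∀ v : EuclideanSpace ℝ (Fin k), c * ‖v‖ ^ 2 ≤ B v v := by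
    rcases (Metric.sphere (0 : EuclideanSpace ℝ (Fin k)) 1).eq_empty_or_nonempty with he | hne
    · refine ⟨1, one_pos, fun v ↦ ?_⟩
      have hv : v = 0 := by
        by_contra hv
        have : ‖v‖⁻¹ • v ∈ Metric.sphere (0 : EuclideanSpace ℝ (Fin k)) 1 := by
          simp [norm_smul, hv]
        simp [he] at this
      simp [hv]
    · obtain ⟨w, hw, hmin⟩ := (isCompact_sphere (0 : EuclideanSpace ℝ (Fin k)) 1).exists_isMinOn
        hne hcont.continuousOn
      have hw0 : w ≠ 0 := by
        rintro rfl
        simp at hw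
      refine ⟨B w w, hB w hw0, fun v ↦ ?_⟩
      rcases eq_or_ne v 0 with rfl | hv
      · simp
      · have hv' : 0 < ‖v‖ := norm_pos_iff.2 hv
        have h1 : B w w ≤ B (‖v‖⁻¹ • v) (‖v‖⁻¹ • v) := hmin (by simp [norm_smul, hv])
        have h2 : B (‖v‖⁻¹ • v) (‖v‖⁻¹ • v) * ‖v‖ ^ 2 = B v v := by
          simp only [map_smul, smul_apply, smul_eq_mul]
          field_simp
        rw [← h2]
        gcongr
  rw [NormedSpace.isVonNBounded_iff']
  refine ⟨√(1 / c), fun v hv ↦ Real.le_sqrt_of_sq_le ?_⟩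
  rw [le_div_iff₀ hc, mul_comm]
  exact (hcB v).trans (le_of_lt hv)

end Riemannian

/-! ### The product `M × ℝ` and its immersed submanifolds -/

variable {n m : ℕ}
  {M : Type*} [TopologicalSpace M] [ChartedSpace (EuclideanSpace ℝ (Fin n)) M]
  {S : Type*} [TopologicalSpace S] [ChartedSpace (EuclideanSpace ℝ (Fin m)) S]

/-- The differential at `p` of the projection `M × ℝ → M`. -/
def dM (p : M × ℝ) (v : TangentSpace ((𝓡 n).prod 𝓘(ℝ, ℝ)) p) : TangentSpace (𝓡 n) p.1 :=
  mfderiv ((𝓡 n).prod 𝓘(ℝ, ℝ)) (𝓡 n) (Prod.fst : M × ℝ → M) p v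

/-- The differential `dt` at `p` of the projection `t : M × ℝ → ℝ`. -/
def dt (p : M × ℝ) (v : TangentSpace ((𝓡 n).prod 𝓘(ℝ, ℝ)) p) : ℝ :=
  mfderiv ((𝓡 n).prod 𝓘(ℝ, ℝ)) 𝓘(ℝ, ℝ) (Prod.snd : M × ℝ → ℝ) p v

variable (n) in
/-- The differential of `F : S → M × ℝ` at `x`. -/
def dF (F : S → M × ℝ) (x : S) (v : TangentSpace (𝓡 m) x) :
    TangentSpace ((𝓡 n).prod 𝓘(ℝ, ℝ)) (F x) :=
  mfderiv (𝓡 m) ((𝓡 n).prod 𝓘(ℝ, ℝ)) F x v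

theorem dM_add (p : M × ℝ) (v w : TangentSpace ((𝓡 n).prod 𝓘(ℝ, ℝ)) p) :
    dM p (v + w) = dM p v + dM p w := map_add _ _ _

theorem dM_smul (p : M × ℝ) (c : ℝ) (v : TangentSpace ((𝓡 n).prod 𝓘(ℝ, ℝ)) p) :
    dM p (c • v) = c • dM p v := map_smul _ _ _

theorem dt_add (p : M × ℝ) (v w : TangentSpace ((𝓡 n).prod 𝓘(ℝ, ℝ)) p) :
    dt p (v + w) = dt p v + dt p w :=
  map_add (mfderiv ((𝓡 n).prod 𝓘(ℝ, ℝ)) 𝓘(ℝ, ℝ) (Prod.snd : M × ℝ → ℝ) p) _ _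

theorem dt_smul (p : M × ℝ) (c : ℝ) (v : TangentSpace ((𝓡 n).prod 𝓘(ℝ, ℝ)) p) :
    dt p (c • v) = c * dt p v :=
  map_smul (mfderiv ((𝓡 n).prod 𝓘(ℝ, ℝ)) 𝓘(ℝ, ℝ) (Prod.snd : M × ℝ → ℝ) p) _ _

theorem dF_add (F : S → M × ℝ) (x : S) (v w : TangentSpace (𝓡 m) x) :
    dF n F x (v + w) = dF n F x v + dF n F x w := map_add _ _ _

theorem dF_smul (F : S → M × ℝ) (x : S) (c : ℝ) (v : TangentSpace (𝓡 m) x) :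
    dF n F x (c • v) = c • dF n F x v := map_smul _ _ _

variable [IsManifold (𝓡 n) ∞ M]

/-- The metric `g_M + ε dt²` of `M × ℝ` at `p`. -/
def prodMetric (gM : ContMDiffRiemannianMetric (𝓡 n) ∞ (EuclideanSpace ℝ (Fin n))
      (fun x : M ↦ TangentSpace (𝓡 n) x)) (ε : ℝ) (p : M × ℝ)
    (v w : TangentSpace ((𝓡 n).prod 𝓘(ℝ, ℝ)) p) : ℝ :=
  gM.inner p.1 (dM p v) (dM p w) + ε * (dt p v * dt p w)

/-- The Lorentzian metric `g_M - dt²`. -/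
abbrev lorentz (gM : ContMDiffRiemannianMetric (𝓡 n) ∞ (EuclideanSpace ℝ (Fin n))
      (fun x : M ↦ TangentSpace (𝓡 n) x)) (p : M × ℝ)
    (v w : TangentSpace ((𝓡 n).prod 𝓘(ℝ, ℝ)) p) : ℝ :=
  prodMetric gM (-1) p v w

/-- The Riemannian metric `g_M + dt²`. -/
abbrev euclid (gM : ContMDiffRiemannianMetric (𝓡 n) ∞ (EuclideanSpace ℝ (Fin n))
      (fun x : M ↦ TangentSpace (𝓡 n) x)) (p : M × ℝ)
    (v w : TangentSpace ((𝓡 n).prod 𝓘(ℝ, ℝ)) p) : ℝ :=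
  prodMetric gM 1 p v w

variable (m) in
/-- A smooth map `F : S → M × ℝ` is a spacelike immersion if the form induced on `S` by
`g_M - dt²` is positive definite. (This forces the differential of `F` to be injective, see
`IsSpacelikeImmersion.injective`.) -/
structure IsSpacelikeImmersion
    (gM : ContMDiffRiemannianMetric (𝓡 n) ∞ (EuclideanSpace ℝ (Fin n))
      (fun x : M ↦ TangentSpace (𝓡 n) x)) (F : S → M × ℝ) : Prop where
  contMDiff : ContMDiff (𝓡 m) ((𝓡 n).prod 𝓘(ℝ, ℝ)) ∞ F
  posDef : ∀ (x : S) (v : TangentSpace (𝓡 m) x), v ≠ 0 → 0 < lorentz gM (F x) (dF n F x v) (dF n F x v)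

section Pullback

variable (gM : ContMDiffRiemannianMetric (𝓡 n) ∞ (EuclideanSpace ℝ (Fin n))
      (fun x : M ↦ TangentSpace (𝓡 n) x)) (F : S → M × ℝ)

variable (m) in
/-- The form `(F^* (g_M + ε dt²))_x` on the tangent space of `S` at `x`. -/
def pullbackBilin (ε : ℝ) (x : S) : TangentSpace (𝓡 m) x →ₗ[ℝ] TangentSpace (𝓡 m) x →ₗ[ℝ] ℝ :=
  LinearMap.mk₂ ℝ (fun v w ↦ prodMetric gM ε (F x) (dF n F x v) (dF n F x w))
    (by intros; simp only [prodMetric, dF_add, dM_add, dt_add, map_add, add_apply]; ring)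
    (by intros; simp only [prodMetric, dF_smul, dM_smul, dt_smul, map_smul, smul_apply,
          smul_eq_mul]; ring)
    (by intros; simp only [prodMetric, dF_add, dM_add, dt_add, map_add]; ring)
    (by intros; simp only [prodMetric, dF_smul, dM_smul, dt_smul, map_smul, smul_eq_mul]; ring)

variable (m) in
/-- The form `(F^* (g_M + ε dt²))_x`, as a continuous bilinear form. -/
def pullbackForm (ε : ℝ) (x : S) : TangentSpace (𝓡 m) x →L[ℝ] TangentSpace (𝓡 m) x →L[ℝ] ℝ :=
  LinearMap.toContinuousBilinearMap (𝕜 := ℝ) (E := EuclideanSpace ℝ (Fin m))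
    (F := EuclideanSpace ℝ (Fin m)) (G := ℝ) (pullbackBilin m gM F ε x)

theorem pullbackForm_apply (ε : ℝ) (x : S) (v w : TangentSpace (𝓡 m) x) :
    pullbackForm m gM F ε x v w = prodMetric gM ε (F x) (dF n F x v) (dF n F x w) := rfl

variable (m) in
/-- The Riemannian metric `F^* (g_M + ε dt²)` on `S`, when this form is positive definite. -/
def pullbackMetric (ε : ℝ)
    (h : ∀ (x : S) (v : TangentSpace (𝓡 m) x), v ≠ 0 →
      0 < prodMetric gM ε (F x) (dF n F x v) (dF n F x v)) :
    RiemannianMetric (fun x : S ↦ TangentSpace (𝓡 m) x) where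
  inner x := pullbackForm m gM F ε x
  symm x v w := by
    simp only [pullbackForm_apply, prodMetric, gM.symm (F x).1 (dM (F x) (dF n F x v)),
      mul_comm (dt (F x) (dF n F x v))]
  pos x v hv := by simpa only [pullbackForm_apply] using h x v hv
  continuousAt x := by
    let B : EuclideanSpace ℝ (Fin m) →L[ℝ] EuclideanSpace ℝ (Fin m) →L[ℝ] ℝ :=
      pullbackForm m gM F ε x
    have : Continuous (fun v : EuclideanSpace ℝ (Fin m) ↦ B v v) := by fun_prop
    exact this.continuousAt
  isVonNBounded x := isVonNBounded_of_posDef (pullbackForm m gM F ε x) (h x)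

variable {gM F}

theorem IsSpacelikeImmersion.injective (hF : IsSpacelikeImmersion m gM F) (x : S) :
    Function.Injective (mfderiv (𝓡 m) ((𝓡 n).prod 𝓘(ℝ, ℝ)) F x) := by
  rw [injective_iff_map_eq_zero]
  intro v hv
  by_contra hne
  have h := hF.posDef x v hne
  have h0 : dF n F x v = (0 : ℝ) • dF n F x v := by
    rw [← dF_smul, zero_smul]
    exact hv.trans (map_zero (mfderiv (𝓡 m) ((𝓡 n).prod 𝓘(ℝ, ℝ)) F x)).symm
  rw [h0] at h
  simp only [prodMetric, dM_smul, dt_smul] at h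
  simp at h

theorem IsSpacelikeImmersion.euclid_pos (hF : IsSpacelikeImmersion m gM F) (x : S)
    (v : TangentSpace (𝓡 m) x) (hv : v ≠ 0) : 0 < euclid gM (F x) (dF n F x v) (dF n F x v) := by
  have h := hF.posDef x v hv
  simp only [prodMetric] at h ⊢
  nlinarith [mul_self_nonneg (dt (F x) (dF n F x v))]

/-- The metric `g = F^* (g_M - dt²)` induced on a spacelike submanifold. -/
def inducedMetric (hF : IsSpacelikeImmersion m gM F) :
    RiemannianMetric (fun x : S ↦ TangentSpace (𝓡 m) x) :=
  pullbackMetric m gM F (-1) hF.posDef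

/-- The metric `g_E = F^* (g_M + dt²)` induced on a spacelike submanifold. -/
def inducedEuclidMetric (hF : IsSpacelikeImmersion m gM F) :
    RiemannianMetric (fun x : S ↦ TangentSpace (𝓡 m) x) :=
  pullbackMetric m gM F 1 hF.euclid_pos

variable (m gM F)

/-- The set of unit timelike vectors at `F x` which are `(g_M - dt²)`-orthogonal to the image of
the tangent space of `S` at `x`. -/
def unitTimelikeNormals (x : S) : Set (TangentSpace ((𝓡 n).prod 𝓘(ℝ, ℝ)) (F x)) :=
  {ν | lorentz gM (F x) ν ν = -1 ∧
    ∀ v : TangentSpace (𝓡 m) x, lorentz gM (F x) ν (dF n F x v) = 0}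

/-- `|ν^min|_E (x)`: the smallest `(g_M + dt²)`-norm of a unit timelike normal vector at `x`
(the infimum is attained: the normal space at `x` is a finite-dimensional Lorentzian space). -/
def minNormalNorm (x : S) : ℝ :=
  sInf ((fun ν ↦ √(euclid gM (F x) ν ν)) '' unitTimelikeNormals m gM F x)

end Pullback

end LorentzProduct

end

open LorentzProduct

/-! A unit timelike normal ν controls the gap between the two induced metrics. Cauchy–Schwarz in
`M`, with the normality relations, gives `|v|_E² ≤ |ν|_E² g(v, v)` for tangent `v`
(`euclid_le_mul_lorentz`). Taking the infimum over ν, the `g_E`-norm is at most `G(r_E)` times the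
`g`-norm.

Put `Φ(r) = ∫_0^r ds / G(s)`. As `r_E` is 1-Lipschitz for `g_E`, `Φ ∘ r_E` grows along a path at
most by a multiple of its `g`-length (`invIntegral_toReal_metricEDist_le`). Since `Φ` is unbounded,
a `g`-Cauchy sequence and short paths joining its late terms stay in a `g_E`-ball. There `G` is
bounded, so the sequence is also `g_E`-Cauchy (`cauchy_of_norm_le_mul`).

Both projections to `M` and ℝ are 1-Lipschitz for `g_E`, so completeness of `M` and ℝ makes the
image sequence converge. Properness of `F` gives a cluster point in Σ, and a Cauchy sequence
converges to its cluster point. -/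

open LorentzProduct

noncomputable section

namespace LorentzProduct

/-! ### Speeds and lengths for a Riemannian metric -/

section Riemannian

variable {k : ℕ} {X : Type*} [TopologicalSpace X] [ChartedSpace (EuclideanSpace ℝ (Fin k)) X]

/-- The norm of a tangent vector for the Riemannian metric `g`. -/
def metricNorm (g : RiemannianMetric (fun x : X ↦ TangentSpace (𝓡 k) x)) {x : X}
    (v : TangentSpace (𝓡 k) x) : ℝ :=
  √(g.inner x v v)

/-- The length of the path `γ` on `[a, b]` for the Riemannian metric `g`. -/
def metricLength (g : RiemannianMetric (fun x : X ↦ TangentSpace (𝓡 k) x)) (γ : ℝ → X)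
    (a b : ℝ) : ℝ≥0∞ :=
  letI : RiemannianBundle (fun x : X ↦ TangentSpace (𝓡 k) x) := ⟨g⟩
  pathELength (𝓡 k) γ a b

variable (g : RiemannianMetric (fun x : X ↦ TangentSpace (𝓡 k) x))

theorem enorm_eq_ofReal_metricNorm {x : X} (v : TangentSpace (𝓡 k) x) :
    letI : RiemannianBundle (fun x : X ↦ TangentSpace (𝓡 k) x) := ⟨g⟩
    ‖v‖ₑ = ENNReal.ofReal (metricNorm g v) := by
  let : RiemannianBundle (fun x : X ↦ TangentSpace (𝓡 k) x) := ⟨g⟩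
  rw [← ofReal_norm, norm_eq_sqrt_real_inner]
  rfl

theorem metricLength_eq_lintegral (γ : ℝ → X) (a b : ℝ) :
    metricLength g γ a b = ∫⁻ t in Icc a b,
      ENNReal.ofReal (metricNorm g (mfderiv 𝓘(ℝ, ℝ) (𝓡 k) γ t (1 : ℝ))) := by
  let : RiemannianBundle (fun x : X ↦ TangentSpace (𝓡 k) x) := ⟨g⟩
  unfold metricLength
  rw [pathELength_eq_lintegral_mfderiv_Icc]
  congr 1 with t
  exact enorm_eq_ofReal_metricNorm g _

theorem metricEDist_self (x : X) : metricEDist g x x = 0 := by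
  let : RiemannianBundle (fun x : X ↦ TangentSpace (𝓡 k) x) := ⟨g⟩
  exact riemannianEDist_self

theorem metricEDist_comm (x y : X) : metricEDist g x y = metricEDist g y x := by
  let : RiemannianBundle (fun x : X ↦ TangentSpace (𝓡 k) x) := ⟨g⟩
  exact riemannianEDist_comm

theorem metricEDist_triangle (x y z : X) :
    metricEDist g x z ≤ metricEDist g x y + metricEDist g y z := by
  let : RiemannianBundle (fun x : X ↦ TangentSpace (𝓡 k) x) := ⟨g⟩
  exact riemannianEDist_triangle

theorem metricEDist_le_metricLength {γ : ℝ → X} (hγ : ContMDiff 𝓘(ℝ, ℝ) (𝓡 k) 1 γ) {a b : ℝ}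
    (hab : a ≤ b) : metricEDist g (γ a) (γ b) ≤ metricLength g γ a b := by
  let : RiemannianBundle (fun x : X ↦ TangentSpace (𝓡 k) x) := ⟨g⟩
  exact riemannianEDist_le_pathELength hγ.contMDiffOn rfl rfl hab

/-- A path can be reparametrized to be constant near its endpoints, hence extended to a `C^1` map on
all of ℝ. This keeps boundary derivatives out of every later argument. -/
theorem exists_metricLength_lt {x y : X} {r : ℝ≥0∞} (h : metricEDist g x y < r) :
    ∃ γ : ℝ → X, γ 0 = x ∧ γ 1 = y ∧ ContMDiff 𝓘(ℝ, ℝ) (𝓡 k) 1 γ ∧ metricLength g γ 0 1 < r := by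
  let : RiemannianBundle (fun x : X ↦ TangentSpace (𝓡 k) x) := ⟨g⟩
  obtain ⟨γ, h0, h1, hγ, hl, -⟩ := exists_lt_locally_constant_of_riemannianEDist_lt
    (I := 𝓡 k) h zero_lt_one
  exact ⟨γ, h0, h1, hγ, hl⟩

theorem metricLength_add (γ : ℝ → X) {a b c : ℝ} (hab : a ≤ b) (hbc : b ≤ c) :
    metricLength g γ a b + metricLength g γ b c = metricLength g γ a c := by
  let : RiemannianBundle (fun x : X ↦ TangentSpace (𝓡 k) x) := ⟨g⟩
  exact pathELength_add hab hbc

theorem metricLength_mono (γ : ℝ → X) {a b a' b' : ℝ} (ha : a' ≤ a) (hb : b ≤ b') :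
    metricLength g γ a b ≤ metricLength g γ a' b' := by
  let : RiemannianBundle (fun x : X ↦ TangentSpace (𝓡 k) x) := ⟨g⟩
  exact pathELength_mono ha hb

/-- Comparison of the lengths of a path for two metrics, from a comparison of the norms along the
path. -/
theorem metricLength_le_mul (g' : RiemannianMetric (fun x : X ↦ TangentSpace (𝓡 k) x))
    (γ : ℝ → X) {a b C : ℝ} (hC : 0 ≤ C)
    (h : ∀ t ∈ Icc a b, ∀ v : TangentSpace (𝓡 k) (γ t), metricNorm g' v ≤ C * metricNorm g v) :
    metricLength g' γ a b ≤ ENNReal.ofReal C * metricLength g γ a b := by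
  rw [metricLength_eq_lintegral, metricLength_eq_lintegral,
    ← lintegral_const_mul' _ _ ENNReal.ofReal_ne_top]
  refine setLIntegral_mono' measurableSet_Icc fun t ht ↦ ?_
  rw [← ENNReal.ofReal_mul hC]
  exact ENNReal.ofReal_le_ofReal (h t ht _)

theorem metricEDist_le_of_norm_le (g' : RiemannianMetric (fun x : X ↦ TangentSpace (𝓡 k) x))
    (h : ∀ (x : X) (v : TangentSpace (𝓡 k) x), metricNorm g' v ≤ metricNorm g v) (x y : X) :
    metricEDist g' x y ≤ metricEDist g x y := by
  refine le_of_forall_gt fun r hr ↦ ?_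
  obtain ⟨γ, rfl, rfl, hγ, hl⟩ := exists_metricLength_lt g hr
  refine ((metricEDist_le_metricLength g' hγ zero_le_one).trans ?_).trans_lt hl
  simpa using metricLength_le_mul g g' γ (a := 0) (b := 1) zero_le_one
    (fun t _ v ↦ by simpa using h _ v)

/-- A `C^1` map to a Riemannian manifold whose differential does not increase norms does not
increase distances. -/
theorem metricEDist_map_le {l : ℕ} {Y : Type*} [TopologicalSpace Y]
    [ChartedSpace (EuclideanSpace ℝ (Fin l)) Y]
    (g' : RiemannianMetric (fun y : Y ↦ TangentSpace (𝓡 l) y)) {f : X → Y}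
    (hf : ContMDiff (𝓡 k) (𝓡 l) 1 f)
    (h : ∀ (x : X) (v : TangentSpace (𝓡 k) x),
      metricNorm g' (mfderiv (𝓡 k) (𝓡 l) f x v) ≤ metricNorm g v) (x y : X) :
    metricEDist g' (f x) (f y) ≤ metricEDist g x y := by
  refine le_of_forall_gt fun r hr ↦ ?_
  obtain ⟨γ, rfl, rfl, hγ, hl⟩ := exists_metricLength_lt g hr
  refine ((metricEDist_le_metricLength g' (hf.comp hγ) zero_le_one).trans ?_).trans_lt hl
  rw [metricLength_eq_lintegral, metricLength_eq_lintegral]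
  refine lintegral_mono fun t ↦ ENNReal.ofReal_le_ofReal ?_
  rw [mfderiv_comp t ((hf _).mdifferentiableAt one_ne_zero)
    ((hγ _).mdifferentiableAt one_ne_zero)]
  exact h _ _

/-- A `C^1` function whose differential does not increase norms does not increase distances. -/
theorem edist_map_le_metricEDist {f : X → ℝ} (hf : ContMDiff (𝓡 k) 𝓘(ℝ, ℝ) 1 f)
    (h : ∀ (x : X) (v : TangentSpace (𝓡 k) x),
      abs (α := ℝ) (mfderiv (𝓡 k) 𝓘(ℝ, ℝ) f x v) ≤ metricNorm g v) (x y : X) :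
    edist (f x) (f y) ≤ metricEDist g x y := by
  refine le_of_forall_gt fun r hr ↦ ?_
  obtain ⟨γ, rfl, rfl, hγ, hl⟩ := exists_metricLength_lt g hr
  refine lt_of_le_of_lt ?_ hl
  have hc : ContMDiff 𝓘(ℝ, ℝ) 𝓘(ℝ, ℝ) 1 (f ∘ γ) := hf.comp hγ
  have key := enorm_sub_le_lintegral_deriv_of_contDiffOn_Icc (f := f ∘ γ)
    hc.contDiff.contDiffOn zero_le_one
  rw [edist_comm, edist_eq_enorm_sub]
  refine key.trans ?_
  rw [metricLength_eq_lintegral]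
  refine lintegral_mono fun t ↦ ?_
  rw [← ofReal_norm]
  refine ENNReal.ofReal_le_ofReal ?_
  have e := mfderiv_comp t ((hf _).mdifferentiableAt one_ne_zero)
    ((hγ t).mdifferentiableAt one_ne_zero)
  rw [mfderiv_eq_fderiv] at e
  have e1 : deriv (f ∘ γ) t = mfderiv (𝓡 k) 𝓘(ℝ, ℝ) f (γ t)
      (mfderiv 𝓘(ℝ, ℝ) (𝓡 k) γ t (1 : ℝ)) := by
    rw [← fderiv_apply_one_eq_deriv, e]
    rfl
  rw [e1]
  exact h _ _

/-- For a continuous Riemannian metric, topologically close points are at small distance. -/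
theorem eventually_metricEDist_lt [IsManifold (𝓡 k) 1 X]
    (hg : Continuous (fun x : X ↦ TotalSpace.mk'
      (EuclideanSpace ℝ (Fin k) →L[ℝ] EuclideanSpace ℝ (Fin k) →L[ℝ] ℝ)
      (E := fun x : X ↦ TangentSpace (𝓡 k) x →L[ℝ] TangentSpace (𝓡 k) x →L[ℝ] ℝ) x (g.inner x)))
    (x : X) {c : ℝ≥0∞} (hc : 0 < c) : ∀ᶠ y in 𝓝 x, metricEDist g x y < c := by
  let : RiemannianBundle (fun x : X ↦ TangentSpace (𝓡 k) x) := ⟨g⟩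
  have : IsContinuousRiemannianBundle (EuclideanSpace ℝ (Fin k))
    (fun x : X ↦ TangentSpace (𝓡 k) x) := ⟨⟨g.inner, hg, fun _ _ _ ↦ rfl⟩⟩
  exact eventually_riemannianEDist_lt (𝓡 k) x hc

/-- For a continuous Riemannian metric, convergence for the distance implies convergence. -/
theorem tendsto_of_tendsto_metricEDist [IsManifold (𝓡 k) 1 X] [T2Space X]
    (hg : Continuous (fun x : X ↦ TotalSpace.mk'
      (EuclideanSpace ℝ (Fin k) →L[ℝ] EuclideanSpace ℝ (Fin k) →L[ℝ] ℝ)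
      (E := fun x : X ↦ TangentSpace (𝓡 k) x →L[ℝ] TangentSpace (𝓡 k) x →L[ℝ] ℝ) x (g.inner x)))
    {u : ℕ → X} {x : X} (h : Tendsto (fun i ↦ metricEDist g (u i) x) atTop (𝓝 0)) :
    Tendsto u atTop (𝓝 x) := by
  let : RiemannianBundle (fun x : X ↦ TangentSpace (𝓡 k) x) := ⟨g⟩
  have : IsContinuousRiemannianBundle (EuclideanSpace ℝ (Fin k))
    (fun x : X ↦ TangentSpace (𝓡 k) x) := ⟨⟨g.inner, hg, fun _ _ _ ↦ rfl⟩⟩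
  have : LocallyCompactSpace X := Manifold.locallyCompact_of_finiteDimensional (𝓡 k)
  intro s hs
  obtain ⟨c, hc, hcs⟩ := setOfPred_riemannianEDist_lt_subset_nhds' (𝓡 k) hs
  rw [Filter.mem_map]
  filter_upwards [(tendsto_order.1 h).2 c hc] with i hi
  refine hcs ?_
  rw [metricEDist_comm] at hi
  exact hi

/-- Each point has a neighbourhood at distance less than 1 from it, so the points at finite distance
from `x` form a nonempty clopen set. -/
theorem metricEDist_ne_top_of_continuous [IsManifold (𝓡 k) 1 X] [ConnectedSpace X]
    (hg : Continuous (fun x : X ↦ TotalSpace.mk'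
      (EuclideanSpace ℝ (Fin k) →L[ℝ] EuclideanSpace ℝ (Fin k) →L[ℝ] ℝ)
      (E := fun x : X ↦ TangentSpace (𝓡 k) x →L[ℝ] TangentSpace (𝓡 k) x →L[ℝ] ℝ) x (g.inner x)))
    (x y : X) : metricEDist g x y ≠ ⊤ := by
  have hclopen : IsClopen {y | metricEDist g x y ≠ ⊤} := by
    refine ⟨⟨isOpen_iff_mem_nhds.2 fun z hz ↦ ?_⟩, isOpen_iff_mem_nhds.2 fun z hz ↦ ?_⟩
    · filter_upwards [eventually_metricEDist_lt g hg z one_pos] with w hw hw'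
      refine hz fun h ↦ ?_
      have := metricEDist_triangle g x w z
      rw [h, metricEDist_comm g w z, top_le_iff] at this
      exact ENNReal.add_ne_top.2 ⟨hw', (hw.trans ENNReal.one_lt_top).ne⟩ this
    · filter_upwards [eventually_metricEDist_lt g hg z one_pos] with w hw
      exact ne_top_of_le_ne_top (ENNReal.add_ne_top.2 ⟨hz, (hw.trans ENNReal.one_lt_top).ne⟩)
        (metricEDist_triangle g x z w)
  have := hclopen.eq_univ ⟨x, by simp [metricEDist_self]⟩
  exact (this ▸ mem_univ y : y ∈ {y | metricEDist g x y ≠ ⊤})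

theorem abs_toReal_metricEDist_sub_le (hfin : ∀ x y : X, metricEDist g x y ≠ ⊤) (o x y : X) :
    |(metricEDist g o y).toReal - (metricEDist g o x).toReal| ≤ (metricEDist g x y).toReal := by
  have h1 := ENNReal.toReal_mono (ENNReal.add_ne_top.2 ⟨hfin _ _, hfin _ _⟩)
    (metricEDist_triangle g o x y)
  have h2 := ENNReal.toReal_mono (ENNReal.add_ne_top.2 ⟨hfin _ _, hfin _ _⟩)
    (metricEDist_triangle g o y x)
  rw [ENNReal.toReal_add (hfin _ _) (hfin _ _)] at h1 h2
  rw [metricEDist_comm g y x] at h2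
  rw [abs_le]
  constructor <;> linarith

theorem continuous_toReal_metricEDist [IsManifold (𝓡 k) 1 X] [ConnectedSpace X]
    (hg : Continuous (fun x : X ↦ TotalSpace.mk'
      (EuclideanSpace ℝ (Fin k) →L[ℝ] EuclideanSpace ℝ (Fin k) →L[ℝ] ℝ)
      (E := fun x : X ↦ TangentSpace (𝓡 k) x →L[ℝ] TangentSpace (𝓡 k) x →L[ℝ] ℝ) x (g.inner x)))
    (o : X) : Continuous (fun x ↦ (metricEDist g o x).toReal) := by
  rw [continuous_iff_continuousAt]
  intro x
  rw [Metric.continuousAt_iff']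
  intro ε hε
  filter_upwards [eventually_metricEDist_lt g hg x (ENNReal.ofReal_pos.2 hε)] with y hy
  rw [Real.dist_eq]
  refine (abs_toReal_metricEDist_sub_le g (metricEDist_ne_top_of_continuous g hg) o x y).trans_lt ?_
  exact (ENNReal.lt_ofReal_iff_toReal_lt (hy.trans ENNReal.ofReal_lt_top).ne).1 hy

end Riemannian

end LorentzProduct

end

noncomputable section

namespace LorentzProduct

variable {n m : ℕ}
  {M : Type*} [TopologicalSpace M] [ChartedSpace (EuclideanSpace ℝ (Fin n)) M]
  {S : Type*} [TopologicalSpace S] [ChartedSpace (EuclideanSpace ℝ (Fin m)) S]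
  [IsManifold (𝓡 n) ∞ M]
  (gM : ContMDiffRiemannianMetric (𝓡 n) ∞ (EuclideanSpace ℝ (Fin n))
      (fun x : M ↦ TangentSpace (𝓡 n) x))
  {F : S → M × ℝ}

/-! ### Continuity of the induced forms -/

theorem continuousAt_dM {Y : Type*} [TopologicalSpace Y] {y : Y} {p : Y → M × ℝ}
    {v : ∀ y, TangentSpace ((𝓡 n).prod 𝓘(ℝ, ℝ)) (p y)}
    (hv : ContinuousAt (fun z ↦ (⟨p z, v z⟩ : TangentBundle ((𝓡 n).prod 𝓘(ℝ, ℝ)) (M × ℝ))) y) :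
    ContinuousAt (fun z ↦ (⟨(p z).1, dM (p z) (v z)⟩ : TangentBundle (𝓡 n) M)) y := by
  have hfst : Continuous (tangentMap ((𝓡 n).prod 𝓘(ℝ, ℝ)) (𝓡 n) (Prod.fst : M × ℝ → M)) :=
    contMDiff_fst.continuous_tangentMap (n := 1) le_rfl
  exact ContinuousAt.comp (f := fun z ↦ (⟨p z, v z⟩ : TangentBundle ((𝓡 n).prod 𝓘(ℝ, ℝ)) (M × ℝ)))
    hfst.continuousAt hv

theorem continuousAt_dt {Y : Type*} [TopologicalSpace Y] {y : Y} {p : Y → M × ℝ}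
    {v : ∀ y, TangentSpace ((𝓡 n).prod 𝓘(ℝ, ℝ)) (p y)}
    (hv : ContinuousAt (fun z ↦ (⟨p z, v z⟩ : TangentBundle ((𝓡 n).prod 𝓘(ℝ, ℝ)) (M × ℝ))) y) :
    ContinuousAt (fun z ↦ dt (p z) (v z)) y := by
  have hsnd : Continuous (tangentMap ((𝓡 n).prod 𝓘(ℝ, ℝ)) 𝓘(ℝ, ℝ) (Prod.snd : M × ℝ → ℝ)) :=
    contMDiff_snd.continuous_tangentMap (n := 1) le_rfl
  have h1 : ContinuousAt (fun z ↦ (⟨(p z).2, dt (p z) (v z)⟩ : TangentBundle 𝓘(ℝ, ℝ) ℝ)) y :=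
    ContinuousAt.comp (f := fun z ↦ (⟨p z, v z⟩ : TangentBundle ((𝓡 n).prod 𝓘(ℝ, ℝ)) (M × ℝ)))
      hsnd.continuousAt hv
  have h2 := (FiberBundle.continuousAt_totalSpace ℝ _).1 h1
  simpa using h2.2

theorem continuousAt_prodMetric {Y : Type*} [TopologicalSpace Y] (ε : ℝ) {y : Y} {p : Y → M × ℝ}
    {v w : ∀ y, TangentSpace ((𝓡 n).prod 𝓘(ℝ, ℝ)) (p y)}
    (hv : ContinuousAt (fun z ↦ (⟨p z, v z⟩ : TangentBundle ((𝓡 n).prod 𝓘(ℝ, ℝ)) (M × ℝ))) y)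
    (hw : ContinuousAt (fun z ↦ (⟨p z, w z⟩ : TangentBundle ((𝓡 n).prod 𝓘(ℝ, ℝ)) (M × ℝ))) y) :
    ContinuousAt (fun z ↦ prodMetric gM ε (p z) (v z) (w z)) y := by
  let : RiemannianBundle (fun x : M ↦ TangentSpace (𝓡 n) x) := ⟨gM.toRiemannianMetric⟩
  have : IsContinuousRiemannianBundle (EuclideanSpace ℝ (Fin n))
    (fun x : M ↦ TangentSpace (𝓡 n) x) := ⟨⟨gM.inner, gM.contMDiff.continuous, fun _ _ _ ↦ rfl⟩⟩
  have h1 : ContinuousAt (fun z ↦ gM.inner (p z).1 (dM (p z) (v z)) (dM (p z) (w z))) y :=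
    ContinuousAt.inner_bundle (F := EuclideanSpace ℝ (Fin n))
      (E := fun x : M ↦ TangentSpace (𝓡 n) x) (b := fun z ↦ (p z).1)
      (v := fun z ↦ dM (p z) (v z)) (w := fun z ↦ dM (p z) (w z))
      (continuousAt_dM hv) (continuousAt_dM hw)
  exact h1.add (continuousAt_const.mul ((continuousAt_dt hv).mul (continuousAt_dt hw)))

/-- The fibres are finite-dimensional, so it suffices to test the form on pairs of vectors that are
constant in a trivialization. For `ε = 1` this makes the topology of Σ comparable with the
`g_E`-distance. -/
theorem continuous_pullbackForm [IsManifold (𝓡 m) ∞ S]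
    (hF : ContMDiff (𝓡 m) ((𝓡 n).prod 𝓘(ℝ, ℝ)) 1 F) (ε : ℝ) :
    Continuous (fun x : S ↦ TotalSpace.mk'
      (EuclideanSpace ℝ (Fin m) →L[ℝ] EuclideanSpace ℝ (Fin m) →L[ℝ] ℝ)
      (E := fun x : S ↦ TangentSpace (𝓡 m) x →L[ℝ] TangentSpace (𝓡 m) x →L[ℝ] ℝ) x
      (pullbackForm m gM F ε x)) := by
  rw [continuous_iff_continuousAt]
  intro x₀
  rw [continuousAt_hom_bundle]
  refine ⟨continuousAt_id, ?_⟩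
  have hT : Continuous (tangentMap (𝓡 m) ((𝓡 n).prod 𝓘(ℝ, ℝ)) F) :=
    hF.continuous_tangentMap le_rfl
  let e := trivializationAt (EuclideanSpace ℝ (Fin m)) (fun x : S ↦ TangentSpace (𝓡 m) x) x₀
  have hx₀ : x₀ ∈ e.baseSet := FiberBundle.mem_baseSet_trivializationAt' x₀
  have hsec : ∀ v : EuclideanSpace ℝ (Fin m),
      ContinuousAt (fun x ↦ (⟨F x, dF n F x (e.symm x v)⟩ :
        TangentBundle ((𝓡 n).prod 𝓘(ℝ, ℝ)) (M × ℝ))) x₀ := by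
    intro v
    have h1 : ContinuousAt (fun x : S ↦ (⟨x, e.symm x v⟩ : TangentBundle (𝓡 m) S)) x₀ := by
      rw [FiberBundle.continuousAt_totalSpace]
      refine ⟨continuousAt_id, continuousAt_const (y := v) |>.congr ?_⟩
      filter_upwards [e.open_baseSet.mem_nhds hx₀] with x hx
      exact (congrArg Prod.snd (e.apply_mk_symm hx v)).symm
    exact hT.continuousAt.comp h1
  rw [continuousAt_clm_apply]
  intro v
  rw [continuousAt_clm_apply]
  intro w
  refine (continuousAt_prodMetric gM ε (hsec v) (hsec w)).congr ?_
  filter_upwards [e.open_baseSet.mem_nhds hx₀] with x hx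
  rw [inCoordinates_apply_eq₂ hx hx (mem_univ _)]
  simp [pullbackForm_apply, e]

/-! ### Comparison of the induced metrics -/

theorem sq_inner_le (x : M) (v w : TangentSpace (𝓡 n) x) :
    gM.inner x v w ^ 2 ≤ gM.inner x v v * gM.inner x w w := by
  let : RiemannianBundle (fun x : M ↦ TangentSpace (𝓡 n) x) := ⟨gM.toRiemannianMetric⟩
  rw [sq]
  exact real_inner_mul_inner_self_le v w

theorem inner_self_nonneg (x : M) (v : TangentSpace (𝓡 n) x) : 0 ≤ gM.inner x v v := by
  rcases eq_or_ne v 0 with rfl | hv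
  · simp
  · exact (gM.pos x v hv).le

theorem prodMetric_comm (ε : ℝ) (p : M × ℝ) (v w : TangentSpace ((𝓡 n).prod 𝓘(ℝ, ℝ)) p) :
    prodMetric gM ε p v w = prodMetric gM ε p w v := by
  simp only [prodMetric, gM.symm p.1 (dM p v), mul_comm (dt p v)]

theorem prodMetric_add_left (ε : ℝ) (p : M × ℝ)
    (u v w : TangentSpace ((𝓡 n).prod 𝓘(ℝ, ℝ)) p) :
    prodMetric gM ε p (u + v) w = prodMetric gM ε p u w + prodMetric gM ε p v w := by
  simp only [prodMetric, dM_add, dt_add, map_add, add_apply]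
  ring

theorem prodMetric_smul_left (ε : ℝ) (p : M × ℝ) (c : ℝ)
    (v w : TangentSpace ((𝓡 n).prod 𝓘(ℝ, ℝ)) p) :
    prodMetric gM ε p (c • v) w = c * prodMetric gM ε p v w := by
  simp only [prodMetric, dM_smul, dt_smul, map_smul, smul_apply, smul_eq_mul]
  ring

-- The field `∂_t`, whose normal part provides a timelike normal.
omit [IsManifold (𝓡 n) ∞ M] in
theorem exists_dM_eq_zero_dt_eq_one (p : M × ℝ) :
    ∃ T : TangentSpace ((𝓡 n).prod 𝓘(ℝ, ℝ)) p, dM p T = 0 ∧ dt p T = 1 := by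
  refine ⟨((0, 1) : EuclideanSpace ℝ (Fin n) × ℝ), ?_, ?_⟩
  · unfold dM
    rw [mfderiv_fst]
    rfl
  · unfold dt
    rw [mfderiv_snd]
    rfl

variable {gM}

/-- A spacelike submanifold has a unit timelike normal vector at each point. -/
theorem unitTimelikeNormals_nonempty (hF : IsSpacelikeImmersion m gM F) (x : S) :
    (unitTimelikeNormals m gM F x).Nonempty := by
  obtain ⟨T, hT0, hT1⟩ := exists_dM_eq_zero_dt_eq_one (n := n) (F x)
  let B : TangentSpace (𝓡 m) x →ₗ[ℝ] Module.Dual ℝ (TangentSpace (𝓡 m) x) :=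
    pullbackBilin m gM F (-1) x
  have : FiniteDimensional ℝ (TangentSpace (𝓡 m) x) :=
    inferInstanceAs (FiniteDimensional ℝ (EuclideanSpace ℝ (Fin m)))
  have hB : ∀ v w, B v w = lorentz gM (F x) (dF n F x v) (dF n F x w) := fun _ _ ↦ rfl
  -- Positive definiteness makes the induced form nondegenerate, so `⟨T, ·⟩` on the tangent space is
  -- represented by some `w`, the tangential part of `T`.
  have hinj : Function.Injective B := by
    rw [injective_iff_map_eq_zero]
    intro v hv
    by_contra hne
    have h := hF.posDef x v hne
    rw [← hB, hv] at h
    simp at h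
  have hsurj : Function.Surjective B :=
    (LinearMap.injective_iff_surjective_of_finrank_eq_finrank Subspace.dual_finrank_eq.symm).1 hinj
  let φ : Module.Dual ℝ (TangentSpace (𝓡 m) x) :=
    { toFun := fun v ↦ lorentz gM (F x) T (dF n F x v)
      map_add' := fun v w ↦ by
        simp only [dF_add, prodMetric_comm gM _ _ T, prodMetric_add_left]
      map_smul' := fun c v ↦ by
        simp only [dF_smul, prodMetric_comm gM _ _ T, prodMetric_smul_left]
        rfl }
  obtain ⟨w, hw⟩ := hsurj φ
  have hw' : ∀ v, lorentz gM (F x) (dF n F x w) (dF n F x v) =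
      lorentz gM (F x) T (dF n F x v) := fun v ↦ by rw [← hB, hw]; rfl
  have hTT : lorentz gM (F x) T T = -1 := by
    simp [prodMetric, hT0, hT1]
  have hww : 0 ≤ lorentz gM (F x) (dF n F x w) (dF n F x w) := by
    rcases eq_or_ne w 0 with rfl | hne
    · rw [← hB]; simp
    · exact (hF.posDef x w hne).le
  set q := lorentz gM (F x) (dF n F x w) (dF n F x w) with hq
  -- The normal part of `T`. Its square is `-1 - q` with `q ≥ 0`, so it is timelike and can be
  -- normalized.
  let ν₀ := T + (-1 : ℝ) • dF n F x w
  have hν₀ : ∀ v, lorentz gM (F x) ν₀ (dF n F x v) = 0 := fun v ↦ by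
    simp only [lorentz, ν₀, prodMetric_add_left, prodMetric_smul_left] at hw' ⊢
    rw [hw' v]
    ring
  have hνν : lorentz gM (F x) ν₀ ν₀ = -(1 + q) := by
    have h1 : lorentz gM (F x) ν₀ ν₀ = lorentz gM (F x) ν₀ T := by
      have := hν₀ w
      simp only [lorentz] at this ⊢
      rw [prodMetric_comm gM _ _ ν₀ ν₀]
      conv_lhs => enter [4]; rw [show ν₀ = T + (-1 : ℝ) • dF n F x w from rfl]
      rw [prodMetric_add_left, prodMetric_smul_left, prodMetric_comm gM _ _ _ ν₀,
        prodMetric_comm gM _ _ _ ν₀, this]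
      ring
    have h2 := hw' w
    rw [← hq] at h2
    rw [h1]
    simp only [lorentz, ν₀, prodMetric_add_left, prodMetric_smul_left] at h2 hTT ⊢
    rw [hTT, prodMetric_comm gM _ _ _ T, ← h2]
    ring
  have hpos : 0 < 1 + q := by linarith
  refine ⟨(√(1 + q))⁻¹ • ν₀, ?_, fun v ↦ ?_⟩
  · simp only [lorentz] at hνν ⊢
    rw [prodMetric_smul_left, prodMetric_comm, prodMetric_smul_left, hνν, ← mul_assoc, ← mul_inv,
      Real.mul_self_sqrt hpos.le]
    field_simp
  · have := hν₀ v
    simp only [lorentz] at this ⊢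
    rw [prodMetric_smul_left, this, mul_zero]

/-- With τ, s the time components of ν and `v`, and `q` the square of the `M`-component of `v`,
normality turns Cauchy–Schwarz into `τ² s² ≤ (τ² - 1) q`. Twice this is the claim `q + s² ≤ (2τ² -
1)(q - s²)`. -/
theorem euclid_le_mul_lorentz {x : S} {ν : TangentSpace ((𝓡 n).prod 𝓘(ℝ, ℝ)) (F x)}
    (hν : ν ∈ unitTimelikeNormals m gM F x) (v : TangentSpace (𝓡 m) x) :
    euclid gM (F x) (dF n F x v) (dF n F x v) ≤
      euclid gM (F x) ν ν * lorentz gM (F x) (dF n F x v) (dF n F x v) := by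
  obtain ⟨h1, h2⟩ := hν
  have h2 := h2 v
  have hcs := sq_inner_le gM (F x).1 (dM (F x) ν) (dM (F x) (dF n F x v))
  simp only [prodMetric] at h1 h2 ⊢
  set a := gM.inner (F x).1 (dM (F x) ν) (dM (F x) ν)
  set b := gM.inner (F x).1 (dM (F x) ν) (dM (F x) (dF n F x v))
  set q := gM.inner (F x).1 (dM (F x) (dF n F x v)) (dM (F x) (dF n F x v))
  set τ := dt (F x) ν
  set s := dt (F x) (dF n F x v)
  have ha : a = τ * τ - 1 := by linarith
  have hb : b = τ * s := by linarith
  rw [hb, ha] at hcs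
  rw [ha]
  nlinarith

theorem lorentz_dF_nonneg (hF : IsSpacelikeImmersion m gM F) (x : S) (v : TangentSpace (𝓡 m) x) :
    0 ≤ lorentz gM (F x) (dF n F x v) (dF n F x v) := by
  rcases eq_or_ne v 0 with rfl | hne
  · have := (pullbackForm_apply (m := m) gM F (-1) x 0 0).symm
    simp only [map_zero] at this
    exact this.ge
  · exact (hF.posDef x v hne).le

/-- The norm of `g_E` is at most `|ν^min|_E` times the norm of `g`. -/
theorem metricNorm_euclid_le (hF : IsSpacelikeImmersion m gM F) (x : S)
    (v : TangentSpace (𝓡 m) x) :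
    metricNorm (inducedEuclidMetric hF) v ≤
      minNormalNorm m gM F x * metricNorm (inducedMetric hF) v := by
  have key : ∀ ν ∈ unitTimelikeNormals m gM F x, metricNorm (inducedEuclidMetric hF) v ≤
      √(euclid gM (F x) ν ν) * metricNorm (inducedMetric hF) v := by
    intro ν hν
    change √(euclid gM (F x) (dF n F x v) (dF n F x v)) ≤
      √(euclid gM (F x) ν ν) * √(lorentz gM (F x) (dF n F x v) (dF n F x v))
    rw [← Real.sqrt_mul' _ (lorentz_dF_nonneg hF x v)]
    exact Real.sqrt_le_sqrt (euclid_le_mul_lorentz hν v)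
  rcases eq_or_ne v 0 with rfl | hne
  · simp [metricNorm]
  · have hpos : 0 < metricNorm (inducedMetric hF) v := Real.sqrt_pos.2 (hF.posDef x v hne)
    rw [← div_le_iff₀ hpos]
    -- Nonemptiness is essential: the real `sInf` of the empty set would be 0.
    refine le_csInf ((unitTimelikeNormals_nonempty hF x).image _) ?_
    rintro _ ⟨ν, hν, rfl⟩
    rw [div_le_iff₀ hpos]
    exact key ν hν

theorem metricNorm_le_euclid (hF : IsSpacelikeImmersion m gM F) (x : S)
    (v : TangentSpace (𝓡 m) x) :
    metricNorm (inducedMetric hF) v ≤ metricNorm (inducedEuclidMetric hF) v := by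
  refine Real.sqrt_le_sqrt ?_
  change prodMetric gM (-1) _ _ _ ≤ prodMetric gM 1 _ _ _
  simp only [prodMetric]
  nlinarith [mul_self_nonneg (dt (F x) (dF n F x v))]

/-- The projection of the submanifold to `M` does not increase distances. -/
theorem metricEDist_fst_le (hF : IsSpacelikeImmersion m gM F) (x y : S) :
    metricEDist gM.toRiemannianMetric (F x).1 (F y).1 ≤
      metricEDist (inducedEuclidMetric hF) x y := by
  have h1 : ContMDiff (𝓡 m) ((𝓡 n).prod 𝓘(ℝ, ℝ)) 1 F := hF.contMDiff.of_le (mod_cast le_top)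
  refine metricEDist_map_le _ gM.toRiemannianMetric (contMDiff_fst.comp h1) (fun x v ↦ ?_) x y
  rw [mfderiv_comp x mdifferentiableAt_fst ((h1 x).mdifferentiableAt one_ne_zero)]
  refine Real.sqrt_le_sqrt ?_
  change gM.inner _ (dM (F x) (dF n F x v)) (dM (F x) (dF n F x v)) ≤ prodMetric gM 1 _ _ _
  simp only [prodMetric]
  nlinarith [mul_self_nonneg (dt (F x) (dF n F x v))]

/-- The projection of the submanifold to `ℝ` does not increase distances. -/
theorem edist_snd_le (hF : IsSpacelikeImmersion m gM F) (x y : S) :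
    edist (F x).2 (F y).2 ≤ metricEDist (inducedEuclidMetric hF) x y := by
  have h1 : ContMDiff (𝓡 m) ((𝓡 n).prod 𝓘(ℝ, ℝ)) 1 F := hF.contMDiff.of_le (mod_cast le_top)
  refine edist_map_le_metricEDist _ (f := Prod.snd ∘ F) (contMDiff_snd.comp h1)
    (fun x v ↦ ?_) x y
  rw [mfderiv_comp x mdifferentiableAt_snd ((h1 x).mdifferentiableAt one_ne_zero)]
  refine Real.abs_le_sqrt ?_
  change dt (F x) (dF n F x v) ^ 2 ≤ prodMetric gM 1 _ _ _
  simp only [prodMetric]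
  nlinarith [inner_self_nonneg gM (F x).1 (dM (F x) (dF n F x v))]

end LorentzProduct

end

namespace LorentzProduct

/-! ### Growth along paths and completeness -/

/-- A local form of `f b ≤ f a + L a b` with additive `L` implies the global one. -/
theorem le_add_of_locally_le_add {f : ℝ → ℝ≥0∞} {L : ℝ → ℝ → ℝ≥0∞} {a b : ℝ} (hab : a ≤ b)
    (hL : ∀ x y z, x ≤ y → y ≤ z → L x y + L y z = L x z)
    (hloc : ∀ t ∈ Icc a b, ∃ U : Set ℝ, IsOpen U ∧ t ∈ U ∧
      ∀ x y, x ≤ y → Icc x y ⊆ U ∩ Icc a b → f y ≤ f x + L x y) :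
    f b ≤ f a + L a b := by
  choose! U hUo hUm hU using hloc
  -- Compactness gives a finite subdivision subordinate to the cover; the local bounds then
  -- telescope.
  obtain ⟨t, ht0, htm, ⟨N, hN⟩, ht⟩ := exists_monotone_Icc_subset_open_cover_Icc hab
    (c := fun i : Icc a b ↦ Subtype.val ⁻¹' U i)
    (fun i ↦ (hUo i i.2).preimage continuous_subtype_val)
    (fun i _ ↦ mem_iUnion.2 ⟨i, hUm i i.2⟩)
  have key : ∀ k, f (t k) ≤ f a + L a (t k) := by
    intro k
    induction k with
    | zero => rw [ht0]; exact le_self_add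
    | succ k ih =>
      obtain ⟨i, hi⟩ := ht k
      have hle : (t k : ℝ) ≤ t (k + 1) := htm k.le_succ
      have hstep : f (t (k + 1)) ≤ f (t k) + L (t k) (t (k + 1)) := by
        refine hU i i.2 _ _ hle fun s hs ↦ ?_
        have hs' : s ∈ Icc a b := ⟨(t k).2.1.trans hs.1, hs.2.trans (t (k + 1)).2.2⟩
        exact ⟨hi (show (⟨s, hs'⟩ : Icc a b) ∈ Icc (t k) (t (k + 1)) from hs), hs'⟩
      rw [← hL a (t k) (t (k + 1)) (t k).2.1 hle, ← add_assoc]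
      exact hstep.trans (add_le_add_left ih _)
  simpa [hN N le_rfl] using key N

/-- The integral of `1 / G` on `[0, r]`. -/
noncomputable def invIntegral (G : ℝ → ℝ) (r : ℝ) : ℝ≥0∞ :=
  ∫⁻ s in Icc 0 r, ENNReal.ofReal (1 / G s)

/-! ### The divergent primitive of `1 / G` -/

section InvIntegral

variable {G : ℝ → ℝ}

theorem invIntegral_mono : Monotone (invIntegral G) :=
  fun _ _ h ↦ lintegral_mono_set (Icc_subset_Icc_right h)

theorem invIntegral_ne_top (hGcont : ContinuousOn G (Ici 0)) (hGpos : ∀ r, 0 ≤ r → 0 < G r)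
    (r : ℝ) : invIntegral G r ≠ ⊤ := by
  have hc : ContinuousOn (fun s ↦ 1 / G s) (Icc 0 r) :=
    continuousOn_const.div (hGcont.mono Icc_subset_Ici_self) fun s hs ↦ (hGpos s hs.1).ne'
  exact (hc.integrableOn_compact isCompact_Icc).lintegral_lt_top.ne

theorem exists_lt_invIntegral (hGint : ∫⁻ r in Ici (0 : ℝ), ENNReal.ofReal (1 / G r) = ⊤)
    {c : ℝ≥0∞} (hc : c ≠ ⊤) : ∃ r, c < invIntegral G r := by
  have hU : Ici (0 : ℝ) = ⋃ k : ℕ, Icc (0 : ℝ) k := by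
    ext s
    simp only [mem_Ici, mem_iUnion, mem_Icc]
    exact ⟨fun h ↦ (exists_nat_ge s).imp fun k hk ↦ ⟨h, hk⟩, fun ⟨k, h, _⟩ ↦ h⟩
  have hmono : Monotone fun k : ℕ ↦ Icc (0 : ℝ) k :=
    fun i j h ↦ Icc_subset_Icc_right (by exact_mod_cast h)
  rw [hU, setLIntegral_iUnion_of_directed _ hmono.directed_le] at hGint
  by_contra! h
  have : (⨆ k : ℕ, invIntegral G k) ≤ c := iSup_le fun k ↦ h k
  exact hc (top_le_iff.1 (hGint ▸ this))

/-- No order between `x` and `y` is needed: for `y < x` the last term is 0 and monotonicity remains.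
-/
theorem invIntegral_le_add {A x y : ℝ} (hA : 0 < A) (h : ∀ s ∈ Icc x y, A ≤ G s) :
    invIntegral G y ≤ invIntegral G x + ENNReal.ofReal (1 / A) * ENNReal.ofReal (y - x) := by
  calc invIntegral G y ≤ ∫⁻ s in Icc 0 x ∪ Icc x y, ENNReal.ofReal (1 / G s) := by
        refine lintegral_mono_set fun s hs ↦ ?_
        rcases le_total s x with hsx | hsx
        · exact Or.inl ⟨hs.1, hsx⟩
        · exact Or.inr ⟨hsx, hs.2⟩
    _ ≤ invIntegral G x + ∫⁻ s in Icc x y, ENNReal.ofReal (1 / G s) := lintegral_union_le _ _ _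
    _ ≤ invIntegral G x + ∫⁻ _ in Icc x y, ENNReal.ofReal (1 / A) := by
        refine add_le_add_right (setLIntegral_mono' measurableSet_Icc fun s hs ↦ ?_) _
        exact ENNReal.ofReal_le_ofReal (one_div_le_one_div_of_le hA (h s hs))
    _ = _ := by simp

end InvIntegral

/-! ### Transfer of Cauchy sequences from `g` to `g'` -/

section Growth

variable {k : ℕ} {X : Type*} [TopologicalSpace X] [ChartedSpace (EuclideanSpace ℝ (Fin k)) X]
  {g g' : RiemannianMetric (fun x : X ↦ TangentSpace (𝓡 k) x)} {o : X} {G : ℝ → ℝ}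

/-- If the norm of `g'` is at most `G(r)` times the norm of `g`, where `r` is the `g'`-distance to
`o`, then the integral of `1 / G` up to `r` grows along a path at most by a multiple of its
`g`-length. -/
theorem invIntegral_toReal_metricEDist_le (hfin : ∀ x y : X, metricEDist g' x y ≠ ⊤)
    (hcont : Continuous fun x ↦ (metricEDist g' o x).toReal)
    (hGcont : ContinuousOn G (Ici 0)) (hGpos : ∀ r, 0 ≤ r → 0 < G r)
    (hle : ∀ (x : X) (v : TangentSpace (𝓡 k) x),
      metricNorm g' v ≤ G (metricEDist g' o x).toReal * metricNorm g v)
    {γ : ℝ → X} (hγ : ContMDiff 𝓘(ℝ, ℝ) (𝓡 k) 1 γ) {a b : ℝ} (hab : a ≤ b) :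
    invIntegral G (metricEDist g' o (γ b)).toReal ≤
      invIntegral G (metricEDist g' o (γ a)).toReal + 4 * metricLength g γ a b := by
  refine le_add_of_locally_le_add (f := fun t ↦ invIntegral G (metricEDist g' o (γ t)).toReal)
    (L := fun a b ↦ 4 * metricLength g γ a b) hab
    (fun x y z hxy hyz ↦ by rw [← mul_add, metricLength_add g γ hxy hyz]) fun t _ ↦ ?_
  set ρ : ℝ → ℝ := fun t ↦ (metricEDist g' o (γ t)).toReal with hρ
  have hρc : Continuous ρ := hcont.comp hγ.continuous
  have hρ0 : ∀ t, 0 ≤ ρ t := fun t ↦ ENNReal.toReal_nonneg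
  set A := G (ρ t) with hAdef
  have hA : 0 < A := hGpos _ (hρ0 t)
  -- The distance ρ need not be differentiable, so `G` is frozen locally up to a factor 2 each way
  -- instead. This costs the factor `(2 / A) * (2 * A) = 4`, which is harmless.
  obtain ⟨δ, hδ, hball⟩ : ∃ δ > 0, ∀ s ∈ Ici (0 : ℝ), |s - ρ t| < δ → A / 2 < G s ∧ G s < 2 * A := by
    have h1 : ∀ᶠ s in 𝓝[Ici 0] (ρ t), G s ∈ Ioo (A / 2) (2 * A) :=
      (hGcont (ρ t) (hρ0 t)).eventually_mem (Ioo_mem_nhds (by linarith) (by linarith))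
    obtain ⟨δ, hδ, h⟩ := Metric.mem_nhdsWithin_iff.1 h1
    exact ⟨δ, hδ, fun s hs hs' ↦ h ⟨by rwa [Metric.mem_ball, Real.dist_eq], hs⟩⟩
  refine ⟨ρ ⁻¹' Metric.ball (ρ t) δ, Metric.isOpen_ball.preimage hρc, by simp [hδ],
    fun x y hxy hsub ↦ ?_⟩
  have hmem : ∀ s ∈ Icc x y, |ρ s - ρ t| < δ := fun s hs ↦ by
    have := (hsub hs).1
    rwa [mem_preimage, Metric.mem_ball, Real.dist_eq] at this
  have hlen : metricLength g' γ x y ≤ ENNReal.ofReal (2 * A) * metricLength g γ x y := by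
    refine metricLength_le_mul g g' γ (by linarith) fun s hs v ↦ (hle _ v).trans ?_
    exact mul_le_mul_of_nonneg_right (hball _ (hρ0 s) (hmem s hs)).2.le (Real.sqrt_nonneg _)
  have hG : ∀ s ∈ Icc (ρ x) (ρ y), A / 2 ≤ G s := fun s hs ↦ by
    refine (hball s ((hρ0 x).trans hs.1) ?_).1.le
    have h1 := abs_lt.1 (hmem x (left_mem_Icc.2 hxy))
    have h2 := abs_lt.1 (hmem y (right_mem_Icc.2 hxy))
    rw [abs_lt]
    constructor <;> linarith [hs.1, hs.2]
  have hdist : ENNReal.ofReal (ρ y - ρ x) ≤ metricLength g' γ x y := by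
    refine le_trans ?_ (metricEDist_le_metricLength g' hγ hxy)
    rw [ENNReal.ofReal_le_iff_le_toReal (hfin _ _)]
    exact (le_abs_self _).trans (abs_toReal_metricEDist_sub_le g' hfin o (γ x) (γ y))
  calc invIntegral G (ρ y)
      ≤ invIntegral G (ρ x) + ENNReal.ofReal (1 / (A / 2)) * ENNReal.ofReal (ρ y - ρ x) :=
        invIntegral_le_add (by linarith) hG
    _ ≤ invIntegral G (ρ x) + ENNReal.ofReal (1 / (A / 2)) *
          (ENNReal.ofReal (2 * A) * metricLength g γ x y) := by
        gcongr
        exact hdist.trans hlen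
    _ = invIntegral G (ρ x) + 4 * metricLength g γ x y := by
        rw [← mul_assoc, ← ENNReal.ofReal_mul (by positivity),
          show 1 / (A / 2) * (2 * A) = 4 by field_simp; norm_num]
        norm_num

/-- Under the same assumptions, and if the integral of `1 / G` diverges, the Cauchy sequences of
`g` are Cauchy for `g'`. -/
theorem cauchy_of_norm_le_mul (hfin : ∀ x y : X, metricEDist g' x y ≠ ⊤)
    (hcont : Continuous fun x ↦ (metricEDist g' o x).toReal)
    (hGcont : ContinuousOn G (Ici 0)) (hGpos : ∀ r, 0 ≤ r → 0 < G r)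
    (hGint : ∫⁻ r in Ici (0 : ℝ), ENNReal.ofReal (1 / G r) = ⊤)
    (hle : ∀ (x : X) (v : TangentSpace (𝓡 k) x),
      metricNorm g' v ≤ G (metricEDist g' o x).toReal * metricNorm g v)
    {u : ℕ → X}
    (hu : ∀ ε : ℝ≥0∞, 0 < ε → ∃ N : ℕ, ∀ i ≥ N, ∀ j ≥ N, metricEDist g (u i) (u j) < ε)
    (ε : ℝ≥0∞) (hε : 0 < ε) : ∃ N : ℕ, ∀ i ≥ N, ∀ j ≥ N, metricEDist g' (u i) (u j) < ε := by
  have hgrow : ∀ {γ : ℝ → X}, ContMDiff 𝓘(ℝ, ℝ) (𝓡 k) 1 γ → metricLength g γ 0 1 < 1 →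
      ∀ t ∈ Icc (0 : ℝ) 1, invIntegral G (metricEDist g' o (γ t)).toReal ≤
        invIntegral G (metricEDist g' o (γ 0)).toReal + 4 := by
    intro γ hγ hl t ht
    refine (invIntegral_toReal_metricEDist_le hfin hcont hGcont hGpos hle hγ ht.1).trans ?_
    gcongr
    calc 4 * metricLength g γ 0 t ≤ 4 * 1 := by
          gcongr
          exact (metricLength_mono g γ le_rfl ht.2).trans hl.le
      _ = 4 := mul_one 4
  obtain ⟨N₀, hN₀⟩ := hu 1 one_pos
  -- One 4 pays for going from `u N₀` to a late term, the other for moving along a path of length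
  -- less than 1 from that term.
  obtain ⟨R, hR⟩ := exists_lt_invIntegral hGint
    (c := invIntegral G (metricEDist g' o (u N₀)).toReal + 4 + 4)
    (by simp [ENNReal.add_eq_top, invIntegral_ne_top hGcont hGpos])
  have hu4 : ∀ i ≥ N₀, invIntegral G (metricEDist g' o (u i)).toReal ≤
      invIntegral G (metricEDist g' o (u N₀)).toReal + 4 := by
    intro i hi
    obtain ⟨γ, h0, h1, hγ, hl⟩ := exists_metricLength_lt g (hN₀ N₀ le_rfl i hi)
    simpa only [h0, h1] using hgrow hγ hl 1 (right_mem_Icc.2 zero_le_one)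
  obtain ⟨C, hC0, hC⟩ : ∃ C : ℝ, 0 < C ∧ ∀ r ∈ Icc 0 R, G r ≤ C := by
    obtain ⟨C, hC⟩ := (isCompact_Icc (a := (0 : ℝ)) (b := R)).bddAbove_image
      (hGcont.mono Icc_subset_Ici_self)
    exact ⟨max C 1, lt_max_of_lt_right one_pos,
      fun r hr ↦ (hC (mem_image_of_mem G hr)).trans (le_max_left _ _)⟩
  -- The 1 confines the joining path to the `g'`-ball of radius `R`; then `ε / C` makes its
  -- `g'`-length less than ε.
  obtain ⟨N₁, hN₁⟩ := hu (min 1 (ε / ENNReal.ofReal C))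
    (lt_min one_pos (ENNReal.div_pos hε.ne' ENNReal.ofReal_ne_top))
  refine ⟨max N₀ N₁, fun i hi j hj ↦ ?_⟩
  obtain ⟨γ, h0, h1, hγ, hl⟩ := exists_metricLength_lt g
    (hN₁ i ((le_max_right _ _).trans hi) j ((le_max_right _ _).trans hj))
  have hbd : ∀ t ∈ Icc (0 : ℝ) 1, (metricEDist g' o (γ t)).toReal ≤ R := by
    intro t ht
    by_contra! h
    refine absurd hR (not_lt.2 ?_)
    refine (invIntegral_mono h.le).trans ((hgrow hγ (hl.trans_le (min_le_left _ _)) t ht).trans ?_)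
    rw [h0]
    gcongr
    exact hu4 i ((le_max_left _ _).trans hi)
  have hlen : metricLength g' γ 0 1 ≤ ENNReal.ofReal C * metricLength g γ 0 1 := by
    refine metricLength_le_mul g g' γ hC0.le fun s hs v ↦ (hle _ v).trans ?_
    exact mul_le_mul_of_nonneg_right (hC _ ⟨ENNReal.toReal_nonneg, hbd s hs⟩) (Real.sqrt_nonneg _)
  rw [← h0, ← h1]
  refine ((metricEDist_le_metricLength g' hγ zero_le_one).trans hlen).trans_lt ?_
  have := hl.trans_le (min_le_right _ _)
  rw [ENNReal.lt_div_iff_mul_lt (Or.inl (ENNReal.ofReal_pos.2 hC0).ne')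
    (Or.inl ENNReal.ofReal_ne_top)] at this
  rwa [mul_comm]

/-- A Cauchy sequence for `g` with a cluster point converges for the distance of `g`. -/
theorem tendsto_metricEDist_of_mapClusterPt {u : ℕ → X} {x : X}
    (hnhds : ∀ ε : ℝ≥0∞, 0 < ε → ∀ᶠ y in 𝓝 x, metricEDist g x y < ε)
    (hu : ∀ ε : ℝ≥0∞, 0 < ε → ∃ N : ℕ, ∀ i ≥ N, ∀ j ≥ N, metricEDist g (u i) (u j) < ε)
    (hx : MapClusterPt x atTop u) : Tendsto (fun i ↦ metricEDist g (u i) x) atTop (𝓝 0) := by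
  rw [ENNReal.tendsto_nhds_zero]
  intro ε hε
  obtain ⟨N, hN⟩ := hu (ε / 2) (ENNReal.half_pos hε.ne')
  obtain ⟨j, hj, hjN⟩ := ((mapClusterPt_iff_frequently.1 hx _
    (hnhds (ε / 2) (ENNReal.half_pos hε.ne'))).and_eventually (eventually_ge_atTop N)).exists
  filter_upwards [eventually_ge_atTop N] with i hi
  refine (metricEDist_triangle g (u i) (u j) x).trans ?_
  rw [metricEDist_comm g (u j) x]
  exact (add_le_add (hN i hi j hjN).le hj.le).trans_eq (ENNReal.add_halves ε)

end Growth

end LorentzProduct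

/-! ### Completeness of the induced metric -/

theorem theorem3p1 {n m : ℕ}
    {M : Type*} [TopologicalSpace M] [T2Space M] [ChartedSpace (EuclideanSpace ℝ (Fin n)) M]
    [IsManifold (𝓡 n) ∞ M]
    (gM : ContMDiffRiemannianMetric (𝓡 n) ∞ (EuclideanSpace ℝ (Fin n))
      (fun x : M ↦ TangentSpace (𝓡 n) x))
    (hM : IsCompleteMetric gM.toRiemannianMetric)
    {S : Type*} [TopologicalSpace S] [T2Space S] [ConnectedSpace S]
    [ChartedSpace (EuclideanSpace ℝ (Fin m)) S] [IsManifold (𝓡 m) ∞ S]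
    (F : S → M × ℝ) (hF : IsSpacelikeImmersion m gM F) (hproper : IsProperMap F)
    (o : S) (G : ℝ → ℝ) (hGcont : ContinuousOn G (Ici 0)) (hGpos : ∀ r, 0 ≤ r → 0 < G r)
    (hGint : ∫⁻ r in Ici (0 : ℝ), ENNReal.ofReal (1 / G r) = ⊤)
    (hbound : ∀ x : S,
      minNormalNorm m gM F x ≤ G (metricEDist (inducedEuclidMetric hF) o x).toReal) :
    IsCompleteMetric (inducedMetric hF) := by
  intro u hu
  have hgE := continuous_pullbackForm gM (hF.contMDiff.of_le (mod_cast le_top)) 1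
  have huE := cauchy_of_norm_le_mul (g := inducedMetric hF) (g' := inducedEuclidMetric hF)
    (metricEDist_ne_top_of_continuous _ hgE) (continuous_toReal_metricEDist _ hgE o)
    hGcont hGpos hGint
    (fun x v ↦ (metricNorm_euclid_le hF x v).trans
      (mul_le_mul_of_nonneg_right (hbound x) (Real.sqrt_nonneg _))) hu
  obtain ⟨p, hp⟩ := hM (fun i ↦ (F (u i)).1) fun ε hε ↦ (huE ε hε).imp fun N hN i hi j hj ↦
    (metricEDist_fst_le hF _ _).trans_lt (hN i hi j hj)
  have hcauchy : CauchySeq fun i ↦ (F (u i)).2 := by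
    rw [EMetric.cauchySeq_iff]
    exact fun ε hε ↦ (huE ε hε).imp fun N hN i hi j hj ↦
      (edist_snd_le hF _ _).trans_lt (hN i hi j hj)
  obtain ⟨t, ht⟩ := cauchySeq_tendsto_of_complete hcauchy
  have hlim : Tendsto (F ∘ u) atTop (𝓝 (p, t)) :=
    (tendsto_of_tendsto_metricEDist _ gM.contMDiff.continuous hp).prodMk_nhds ht
  -- Properness lifts the limit of the images to a cluster point of `u`.
  obtain ⟨x, -, hx⟩ := (isProperMap_iff_clusterPt F).1 hproper |>.2
    (ℱ := map u atTop) (y := (p, t)) hlim.mapClusterPt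
  refine ⟨x, tendsto_metricEDist_of_mapClusterPt (fun ε hε ↦ ?_) hu hx⟩
  -- Since `g ≤ g_E`, small `g_E`-distance near `x` gives small `g`-distance.
  filter_upwards [eventually_metricEDist_lt (inducedEuclidMetric hF) hgE x hε] with y hy
  exact (metricEDist_le_of_norm_le _ _ (metricNorm_le_euclid hF) x y).trans_lt hy
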